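/- Let $X$ be a finite set and $X^\omega$ the space of infinite words over $X$, with the product topology and the metric $d(\xi,\eta)=2^{-|\xi\wedge\eta|}$, where $\xi\wedge\eta$ is the longest common prefix. Let $(G,X)$ be a self-similar group: $G$ is a group acting faithfully by isometries on $X^\omega$ such that for all $g\in G$, $x\in X$ there is a (necessarily unique) $g|_x\in G$ with $g(x\xi)=g(x)\,g|_x(\xi)$ for all $\xi\in X^\omega$. For finite words $v\in X^*$ put $g|_\emptyset=g$, $g|_{xu}=(g|_x)|_u$, $g(\emptyset)=\emptyset$, $g(xu)=g(x)\,g|_x(u)$. Assume that $(G,X)$ is contracting: there is a finite $N\subseteq G$ with $n|_x\in N$ for all $n\in N$, $x\in X$, and such that for every $g\in G$ there is $m\ge 0$ with $g|_w\in N$ for all $w\in X^m$. Let $S(G,X)$ be the inverse semigroup with zero whose nonzero elements are uniquely of the form $s_v u_g s_w^*$ with $v,w\in X^*$, $g\in G$ (generated by the group elements $u_g$ and elements $s_x$, $x\in X$, with $u_gs_x=s_{g(x)}u_{g|_x}$, $s_x^*s_x=1$, and $s_x^*s_y=0$ for $x\ne y$), acting on $X^\omega$ by $s_vu_gs_w^*\colon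 w\xi\mapsto v\,g(\xi)$, with domain $wX^\omega$. Let $\mathcal G=\mathcal G(G,X)$ be the groupoid of germs $[s,\rho]$ of this action ($\rho$ in the domain of $s$; $[s,\rho]=[t,\rho]$ if and only if $se=te$ for some idempotent $e\in S(G,X)$ with $\rho$ in its domain). The source and the range of $[s,\rho]$ are $\rho$ and $s(\rho)$, and the sets $\{[s,\rho] : \rho\in U\}$, for $s\in S(G,X)$ and $U$ an open subset of the domain of $s$, form a basis of the topology. Let $\mathbb C(G,X)=\mathbb C\mathcal G$ be the span of the indicator functions of compact open bisections of $\mathcal G$, where a bisection is a set on which source and range restrict to homeomorphisms onto their images. The algebraic essential ideal $I_{\mathrm{ess}}^{\mathrm{alg}}(G,X)$ consists of the $f\in\mathbb C\mathcal G$ for which $\{\gamma : f(\gamma)\neq 0\}$ has empty interior in $\mathcal G$. For a non-empty word $w\in X^+$ let $H_w$ be the subgroup $\{g\in G : g(w)=w,\ g|_w=g\}$, and map the group algebra $\mathbb CH_w$ to $\mathbb C\mathcal G$ linearly by sending $g$ to the indicator function of $\{[u_g,\rho] : \rho\in X^\omega\}$. Proposition. If $I_{\mathrm{ess}}^{\mathrm{alg}}(G,X)\neq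 0$, then there are $w\in X^+$ and $0\neq a\in\mathbb CH_w$ whose image in $\mathbb C\mathcal G$ is nonzero and lies in $I_{\mathrm{ess}}^{\mathrm{alg}}(G,X)$. -/

import Mathlib

noncomputable section

namespace SelfSimilar

/-- Infinite words `x₀x₁x₂⋯` over the alphabet `X`. -/
def InfWord (X : Type*) : Type _ := ℕ → X

/-- The product topology, for the discrete topology on `X`. -/
instance (X : Type*) : TopologicalSpace (InfWord X) :=
  @Pi.topologicalSpace ℕ (fun _ => X) (fun _ => ⊥)

/-- The infinite word `xξ`. -/
def cons {X : Type*} (x : X) (ξ : InfWord X) : InfWord X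
  | 0 => x
  | n + 1 => ξ n

/-- The infinite word `vξ`, for a finite word `v`. -/
def append {X : Type*} : List X → InfWord X → InfWord X
  | [], ξ => ξ
  | x :: v, ξ => cons x (append v ξ)

/-- The infinite word `ξ` without its first `n` letters. -/
def drop {X : Type*} (n : ℕ) (ξ : InfWord X) : InfWord X := fun k => ξ (n + k)

/-- The clopen set `wX^ω` of infinite words with prefix `w`. -/
def cylinder {X : Type*} (w : List X) : Set (InfWord X) := {ξ | ∃ τ, ξ = append w τ}

/-- The infinite word `xxx⋯`. -/
def const {X : Type*} (x : X) : InfWord X := fun _ => x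

/-- The image `g(x)` of a letter: the first letter of `g(xxx⋯)`. For an action by isometries this
is the first letter of `g(xξ)` for every `ξ`. -/
def letterAct {G X : Type*} [Group G] [MulAction G (InfWord X)] (g : G) (x : X) : X :=
  (g • const x) 0

/-- `(G, X)` is a self-similar group: `G` acts faithfully on `X^ω` by isometries for the metric
`2 ^ (-length of the longest common prefix)` and for all `g`, `x` there is `h = g|_x` in `G` with
`g(xξ) = g(x) h(ξ)` for all `ξ`. -/
class IsSelfSimilar (G X : Type*) [Group G] [MulAction G (InfWord X)] : Prop where
  faithful : ∀ g h : G, (∀ ξ : InfWord X, g • ξ = h • ξ) → g = h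
  isometry : ∀ (g : G) (ξ η : InfWord X) (n : ℕ),
    (∀ i < n, (g • ξ) i = (g • η) i) ↔ (∀ i < n, ξ i = η i)
  exists_section : ∀ (g : G) (x : X), ∃ h : G, ∀ ξ : InfWord X,
    g • cons x ξ = cons (letterAct g x) (h • ξ)

section Words

variable {G X : Type*} [Group G] [MulAction G (InfWord X)] [IsSelfSimilar G X]

/-- The section `g|_x` at a letter; it is unique because the action is faithful. -/
def letterSection (g : G) (x : X) : G := (IsSelfSimilar.exists_section g x).choose

/-- The section `g|_w` at a finite word: `g|_∅ = g` and `g|_{xu} = (g|_x)|_u`. -/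
def wordSection (g : G) : List X → G
  | [] => g
  | x :: u => wordSection (letterSection g x) u

/-- The induced action of `G` on finite words: `g(∅) = ∅` and `g(xu) = g(x) g|_x(u)`. -/
def wordAct (g : G) : List X → List X
  | [] => []
  | x :: u => letterAct g x :: wordAct (letterSection g x) u

theorem smul_cons (g : G) (x : X) (ξ : InfWord X) :
    g • cons x ξ = cons (letterAct g x) (letterSection g x • ξ) :=
  (IsSelfSimilar.exists_section g x).choose_spec ξ

theorem cons_inj {x y : X} {ξ η : InfWord X} (h : cons x ξ = cons y η) : x = y ∧ ξ = η :=
  ⟨congrFun h 0, funext fun n => congrFun h (n + 1)⟩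

theorem append_append (u v : List X) (ξ : InfWord X) :
    append (u ++ v) ξ = append u (append v ξ) := by
  induction u with
  | nil => rfl
  | cons x u ih => simp [append, ih]

theorem append_inj (v : List X) {ξ η : InfWord X} (h : append v ξ = append v η) : ξ = η := by
  induction v with
  | nil => exact h
  | cons x v ih => exact ih (cons_inj h).2

theorem drop_append (v : List X) (ξ : InfWord X) : drop v.length (append v ξ) = ξ := by
  induction v with
  | nil => funext k; simp [drop, append]
  | cons x v ih =>
    refine Eq.trans (funext fun k => ?_) ih
    have h : v.length + 1 + k = (v.length + k) + 1 := by omega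
    simp only [drop, append, List.length_cons, h, cons]

theorem smul_append (g : G) (v : List X) (ξ : InfWord X) :
    g • append v ξ = append (wordAct g v) (wordSection g v • ξ) := by
  induction v generalizing g with
  | nil => rfl
  | cons x v ih => simp [append, smul_cons, wordAct, wordSection, ih]

theorem wordSection_append (g : G) (u v : List X) :
    wordSection g (u ++ v) = wordSection (wordSection g u) v := by
  induction u generalizing g with
  | nil => rfl
  | cons x u ih => simp [wordSection, ih]

theorem wordAct_append (g : G) (u v : List X) :
    wordAct g (u ++ v) = wordAct g u ++ wordAct (wordSection g u) v := by
  induction u generalizing g with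
  | nil => rfl
  | cons x u ih => simp [wordAct, wordSection, ih]

theorem letter_mul (g h : G) (x : X) :
    letterAct (g * h) x = letterAct g (letterAct h x) ∧
      letterSection (g * h) x = letterSection g (letterAct h x) * letterSection h x := by
  have key (ξ : InfWord X) := smul_cons (g * h) x ξ
  simp only [mul_smul, smul_cons] at key
  refine ⟨(cons_inj (key (const x))).1.symm, IsSelfSimilar.faithful (X := X) _ _ fun ξ => ?_⟩
  rw [mul_smul]
  exact (cons_inj (key ξ)).2.symm

theorem letter_one (x : X) :
    letterAct (1 : G) x = x ∧ letterSection (1 : G) x = 1 := by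
  have key (ξ : InfWord X) := smul_cons (1 : G) x ξ
  simp only [one_smul] at key
  refine ⟨(cons_inj (key (const x))).1.symm, IsSelfSimilar.faithful (X := X) _ _ fun ξ => ?_⟩
  rw [one_smul]
  exact (cons_inj (key ξ)).2.symm

theorem word_mul (g h : G) (v : List X) :
    wordAct (g * h) v = wordAct g (wordAct h v) ∧
      wordSection (g * h) v = wordSection g (wordAct h v) * wordSection h v := by
  induction v generalizing g h with
  | nil => exact ⟨rfl, rfl⟩
  | cons x v ih => simp [wordAct, wordSection, letter_mul, ih]

theorem word_one (v : List X) :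
    wordAct (1 : G) v = v ∧ wordSection (1 : G) v = 1 := by
  induction v with
  | nil => exact ⟨rfl, rfl⟩
  | cons x v ih => simp [wordAct, wordSection, letter_one, ih]

variable (G) in
/-- The group `H_w` of all `g` with `g(w) = w` and `g|_w = g`. -/
def cycleSubgroup (w : List X) : Subgroup G where
  carrier := {g | wordAct g w = w ∧ wordSection g w = g}
  one_mem' := word_one w
  mul_mem' := by
    rintro g h ⟨hg, hg'⟩ ⟨hh, hh'⟩
    simp [word_mul, *]
  inv_mem' := by
    rintro g ⟨hg, hg'⟩
    have h1 := word_mul g⁻¹ g w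
    simp only [inv_mul_cancel, word_one, hg, hg'] at h1
    exact ⟨h1.1.symm, eq_inv_of_mul_eq_one_left h1.2.symm⟩

end Words

/-- `(G, X)` is contracting: there is a finite `N ⊆ G`, closed under sections at letters, such that
for each `g` in `G` all sections of `g` at the words of some length `m` lie in `N`. -/
def IsContracting (G X : Type*) [Group G] [MulAction G (InfWord X)] [IsSelfSimilar G X] : Prop :=
  ∃ N : Set G, N.Finite ∧ (∀ g ∈ N, ∀ x : X, letterSection g x ∈ N) ∧
    ∀ g : G, ∃ m : ℕ, ∀ w : List X, w.length = m → wordSection g w ∈ N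

/-- The nonzero elements `s_v u_g s_w^*` of the inverse semigroup `S(G, X)`, in normal form. -/
@[ext] structure Elem (G X : Type*) where
  v : List X
  g : G
  w : List X

section Germs

variable {G X : Type*} [Group G] [MulAction G (InfWord X)] [IsSelfSimilar G X]

/-- The product of `s_v u_g s_w^*` with the idempotent `s_{wp} s_{wp}^*`, which is
`s_v u_g s_p s_{wp}^* = s_{v g(p)} u_{g|_p} s_{wp}^*`. -/
def Elem.restrict (s : Elem G X) (p : List X) : Elem G X :=
  ⟨s.v ++ wordAct s.g p, wordSection s.g p, s.w ++ p⟩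

/-- The partial homeomorphism `wξ ↦ v g(ξ)` of `X^ω` with domain `wX^ω` given by `s_v u_g s_w^*`
(used only on its domain). -/
def Elem.act (s : Elem G X) (ρ : InfWord X) : InfWord X :=
  append s.v (s.g • drop s.w.length ρ)

theorem Elem.restrict_append (s : Elem G X) (p q : List X) :
    s.restrict (p ++ q) = (s.restrict p).restrict q := by
  simp [Elem.restrict, wordAct_append, wordSection_append]

theorem Elem.act_restrict (s : Elem G X) (p : List X) {ρ : InfWord X}
    (h : ρ ∈ cylinder (s.w ++ p)) : (s.restrict p).act ρ = s.act ρ := by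
  obtain ⟨τ, rfl⟩ := h
  have h1 := drop_append (s.w ++ p) τ
  have h2 := drop_append s.w (append p τ)
  rw [← append_append] at h2
  simp only [Elem.act, Elem.restrict]
  rw [h1, h2, smul_append, append_append]

theorem prefix_total (u v : List X) {ρ : InfWord X} (hu : ρ ∈ cylinder u) (hv : ρ ∈ cylinder v) :
    (∃ m, v = u ++ m) ∨ ∃ m, u = v ++ m := by
  induction u generalizing v ρ with
  | nil => exact .inl ⟨v, rfl⟩
  | cons x u ih =>
    cases v with
    | nil => exact .inr ⟨_, rfl⟩
    | cons y v =>
      obtain ⟨τ, rfl⟩ := hu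
      obtain ⟨σ, hσ⟩ := hv
      obtain ⟨rfl, h⟩ := cons_inj hσ
      rcases ih v ⟨τ, rfl⟩ ⟨σ, h⟩ with ⟨m, rfl⟩ | ⟨m, rfl⟩
      · exact .inl ⟨m, rfl⟩
      · exact .inr ⟨m, rfl⟩

variable (G X) in
/-- Pairs of an element of `S(G, X)` and a point of its domain. -/
def PreGerm : Type _ := {a : Elem G X × InfWord X // a.2 ∈ cylinder a.1.w}

/-- Two pairs `(s, ρ)` and `(t, ρ)` define the same germ if `s e = t e` for an idempotent
`e = s_z s_z^*` of `S(G, X)` with `ρ` in its domain `zX^ω`; one may take `z = wp = w'q` longer than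
the words `w`, `w'` of `s = s_v u_g s_w^*` and `t = s_v' u_g' s_w'^*`. -/
def PreGerm.Rel (a b : PreGerm G X) : Prop :=
  a.1.2 = b.1.2 ∧ ∃ p q : List X,
    a.1.2 ∈ cylinder (a.1.1.w ++ p) ∧ a.1.1.restrict p = b.1.1.restrict q

theorem Elem.w_eq {s t : Elem G X} {p q : List X} (h : s.restrict p = t.restrict q) :
    s.w ++ p = t.w ++ q := congrArg Elem.w h

theorem PreGerm.Rel.symm {a b : PreGerm G X} (h : a.Rel b) : b.Rel a := by
  obtain ⟨h1, p, q, h2, h3⟩ := h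
  exact ⟨h1.symm, q, p, by rw [← h1, ← Elem.w_eq h3]; exact h2, h3.symm⟩

theorem PreGerm.Rel.trans {a b c : PreGerm G X} (hab : a.Rel b) (hbc : b.Rel c) : a.Rel c := by
  obtain ⟨h1, p, q, h2, h3⟩ := hab
  obtain ⟨k1, p', q', k2, k3⟩ := hbc
  have h2' := h2
  rw [Elem.w_eq h3, h1] at h2'
  refine ⟨h1.trans k1, ?_⟩
  rcases prefix_total _ _ h2' k2 with ⟨m, hm⟩ | ⟨m, hm⟩
  · rw [List.append_assoc, List.append_cancel_left_eq] at hm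
    subst hm
    refine ⟨p ++ m, q', ?_, ?_⟩
    · rw [← List.append_assoc, Elem.w_eq h3, List.append_assoc, h1]
      exact k2
    · rw [Elem.restrict_append, h3, ← Elem.restrict_append, k3]
  · rw [List.append_assoc, List.append_cancel_left_eq] at hm
    subst hm
    refine ⟨p, q' ++ m, h2, ?_⟩
    rw [Elem.restrict_append, ← k3, ← Elem.restrict_append, h3]

instance PreGerm.setoid : Setoid (PreGerm G X) where
  r := PreGerm.Rel
  iseqv :=
    { refl := fun a => ⟨rfl, [], [], by simpa using a.2, rfl⟩
      symm := PreGerm.Rel.symm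
      trans := PreGerm.Rel.trans }

variable (G X) in
/-- The groupoid `𝒢(G, X)` of germs of the action of `S(G, X)` on `X^ω`. Its unit space is
identified with `X^ω`. Only its topology and its source and range maps are needed below. -/
def Germ : Type _ := Quotient (PreGerm.setoid (G := G) (X := X))

/-- The germ `[s, ρ]`. -/
def germ (s : Elem G X) (ρ : InfWord X) (h : ρ ∈ cylinder s.w) : Germ G X :=
  Quotient.mk PreGerm.setoid ⟨(s, ρ), h⟩

/-- The source `ρ` of a germ `[s, ρ]`. -/
def Germ.source (γ : Germ G X) : InfWord X :=
  Quotient.lift (fun a : PreGerm G X => a.1.2) (fun a b (h : PreGerm.Rel a b) => h.1) γ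

/-- The range `s(ρ)` of a germ `[s, ρ]`. -/
def Germ.range (γ : Germ G X) : InfWord X :=
  Quotient.lift (fun a : PreGerm G X => a.1.1.act a.1.2)
    (by
      rintro a b ⟨h1, p, q, h2, h3⟩
      have h2' := h2
      rw [Elem.w_eq h3, h1] at h2'
      show a.1.1.act a.1.2 = b.1.1.act b.1.2
      rw [← Elem.act_restrict _ p h2, ← Elem.act_restrict _ q h2', h3, h1]) γ

/-- The set of all germs `[s, ρ]` of `s` at points `ρ` of `U` (in the domain of `s`). -/
def germSet (s : Elem G X) (U : Set (InfWord X)) : Set (Germ G X) :=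
  {γ | ∃ (ρ : InfWord X) (h : ρ ∈ cylinder s.w), ρ ∈ U ∧ γ = germ s ρ h}

/-- The topology of the groupoid of germs: the sets of germs of `s` at the points of an open set
form a basis. -/
instance : TopologicalSpace (Germ G X) :=
  TopologicalSpace.generateFrom
    {A | ∃ (s : Elem G X) (U : Set (InfWord X)), IsOpen U ∧ A = germSet s U}

/-- A bisection: source and range restrict to homeomorphisms onto their images. -/
def IsBisection (A : Set (Germ G X)) : Prop :=
  Topology.IsEmbedding (fun γ : A => γ.1.source) ∧ Topology.IsEmbedding (fun γ : A => γ.1.range)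

variable (G X) in
/-- The algebra `ℂ𝒢` of the groupoid of germs, as a space of functions on it: the linear span of
the indicator functions of compact open bisections. It is the model of the algebra `ℂ(G, X)`. -/
def groupoidAlgebra : Submodule ℂ (Germ G X → ℂ) :=
  Submodule.span ℂ {f | ∃ A : Set (Germ G X), IsCompact A ∧ IsOpen A ∧ IsBisection A ∧
    f = A.indicator (fun _ => (1 : ℂ))}

variable (G X) in
/-- The algebraic essential ideal: the elements of `ℂ𝒢` whose strict support has empty interior. -/
def algEssentialIdeal : Set (Germ G X → ℂ) :=
  {f | f ∈ groupoidAlgebra G X ∧ interior (Function.support f) = ∅}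

/-- The element `u_g` of `ℂ𝒢`: the indicator function of the set of germs of `ξ ↦ g(ξ)`. -/
def unitaryElem (g : G) : Germ G X → ℂ :=
  (germSet (⟨[], g, []⟩ : Elem G X) Set.univ).indicator (fun _ => (1 : ℂ))

/-- The image `∑ a_g u_g` in `ℂ𝒢` of an element `∑ a_g g` of the group algebra of `H_w`. -/
def ofGroupAlgebra {w : List X} (a : MonoidAlgebra ℂ (cycleSubgroup G w)) : Germ G X → ℂ :=
  ∑ h ∈ a.coeff.support, a.coeff h • unitaryElem (h : G)

end Germs

end SelfSimilar

end

/-!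
The idea is to move a nonzero element `f` of the essential ideal, by compressions
`f ↦ (s_v u_k)^* f s_w`, into the group algebra and then into the group algebra of a single `H_w`.

Write `arrow v g w ρ` for the germ of `s_v u_g s_w^*` at `wρ`. The maps `arrow v g w` are continuous
and open and cover the groupoid, which settles all topological questions. As cylinders are nested
or disjoint, `f` is a finite combination of indicator functions of sets `range (arrow v g w)`
(`groupoidAlgebra_le_arrowSpan`). Take a germ `γ = arrow v k w ξ` with `f γ ≠ 0` and `w` longer than
the words of that combination. The function `arrow [] g [] ρ ↦ f (arrow v (k * g) w ρ)` is then given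
by an element `c` of `ℂG` (`exists_groupElem_eq`); it is nonzero at the unit `ξ`, and its support has
empty interior because the map on germs is open (`interior_support_groupElem`).

For a prefix `u` of `ξ`, compression of `c` by `s_u` keeps those `h` with `h(u) = u`, replaces them by
`h|_u`, and does not change the value at the germ of the unit over the shifted word
(`groupElem_stabilizerSection`). For long `u` the `h` in the support of `c` that survive fix `ξ`, and
by contraction their sections `h|_u` lie in a fixed finite set. By the pigeonhole principle there are
prefixes `u` and `uw` with `w` non-empty and `h|_u = h|_{uw} = (h|_u)|_w` for all of these `h`, so that
every `h|_u` is in `H_w` (`exists_wordSection_mem_cycleSubgroup`).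
-/

noncomputable section

namespace SelfSimilar

open Set Topology

/-! ### Infinite words and cylinders -/

section InfiniteWords

variable {X : Type*}

theorem append_apply (v : List X) (ξ : InfWord X) (k : ℕ) :
    append v ξ k = if h : k < v.length then v[k] else ξ (k - v.length) := by
  induction v generalizing k with
  | nil => simp [append]
  | cons x v ih =>
    cases k with
    | zero => simp [append, cons]
    | succ k => simp [append, cons, ih]

/-- The prefix of length `n` of an infinite word. -/
def initial (n : ℕ) (ξ : InfWord X) : List X := (List.range n).map fun i => ξ i

@[simp]
theorem length_initial (n : ℕ) (ξ : InfWord X) : (initial n ξ).length = n := by simp [initial]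

theorem initial_add (n m : ℕ) (ξ : InfWord X) :
    initial (n + m) ξ = initial n ξ ++ initial m (drop n ξ) := by
  simp [initial, List.range_add, drop, Function.comp_def]

theorem append_initial_drop (n : ℕ) (ξ : InfWord X) :
    append (initial n ξ) (drop n ξ) = ξ := by
  funext k
  rw [append_apply]
  split_ifs with h
  · simp [initial]
  · rw [length_initial] at h ⊢
    simp only [drop]
    congr 1
    omega

theorem mem_cylinder_initial (n : ℕ) (ξ : InfWord X) : ξ ∈ cylinder (initial n ξ) :=
  ⟨drop n ξ, (append_initial_drop n ξ).symm⟩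

theorem mem_cylinder_iff {w : List X} {ρ : InfWord X} :
    ρ ∈ cylinder w ↔ ∀ i (h : i < w.length), ρ i = w[i] := by
  constructor
  · rintro ⟨τ, rfl⟩ i h
    rw [append_apply, dif_pos h]
  · intro H
    refine ⟨drop w.length ρ, funext fun k => ?_⟩
    rw [append_apply]
    split_ifs with h
    · exact H k h
    · simp only [drop]
      congr 1
      omega

theorem mem_cylinder_initial_iff {n : ℕ} {ρ η : InfWord X} :
    η ∈ cylinder (initial n ρ) ↔ ∀ i < n, η i = ρ i := by
  simp [mem_cylinder_iff, initial]

theorem append_mem_cylinder_iff {w p : List X} {ρ : InfWord X} :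
    append w ρ ∈ cylinder (w ++ p) ↔ ρ ∈ cylinder p := by
  constructor
  · rintro ⟨τ, h⟩
    exact ⟨τ, append_inj w (by rw [h, append_append])⟩
  · rintro ⟨τ, rfl⟩
    exact ⟨τ, (append_append _ _ _).symm⟩

theorem cylinder_append_subset (w p : List X) : cylinder (w ++ p) ⊆ cylinder w := by
  rintro _ ⟨τ, rfl⟩
  exact ⟨append p τ, append_append _ _ _⟩

theorem isOpen_infWord_iff {U : Set (InfWord X)} :
    IsOpen U ↔ ∀ ρ ∈ U, ∃ w, ρ ∈ cylinder w ∧ cylinder w ⊆ U := by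
  let _ : TopologicalSpace X := ⊥
  have _ : DiscreteTopology X := ⟨rfl⟩
  constructor
  · intro hU ρ hρ
    obtain ⟨I, u, hu, hI⟩ := (isOpen_pi_iff (A := fun _ : ℕ => X)).1 hU ρ hρ
    refine ⟨initial (I.sup id + 1) ρ, mem_cylinder_initial _ _, fun η hη => hI fun i hi => ?_⟩
    rw [mem_cylinder_initial_iff] at hη
    rw [hη i (Nat.lt_succ_of_le (Finset.le_sup (f := id) hi))]
    exact (hu i hi).2
  · intro H
    refine (isOpen_pi_iff (A := fun _ : ℕ => X)).2 fun ρ hρ => ?_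
    obtain ⟨w, hw, hU⟩ := H ρ hρ
    refine ⟨Finset.range w.length, fun i => {ρ i}, fun i _ => ⟨isOpen_discrete _, rfl⟩,
      fun η hη => hU ?_⟩
    exact mem_cylinder_iff.2 fun i hi =>
      (hη i (by simpa using hi)).trans (mem_cylinder_iff.1 hw i hi)

theorem isOpen_cylinder (w : List X) : IsOpen (cylinder w) :=
  isOpen_infWord_iff.2 fun _ h => ⟨w, h, Subset.rfl⟩

theorem exists_cylinder_subset {U : Set (InfWord X)} (hU : IsOpen U) (w : List X) {ρ : InfWord X}
    (h : append w ρ ∈ U) : ∃ p, ρ ∈ cylinder p ∧ cylinder (w ++ p) ⊆ U := by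
  obtain ⟨z, hz, hzU⟩ := isOpen_infWord_iff.1 hU _ h
  rcases prefix_total w z ⟨ρ, rfl⟩ hz with ⟨m, rfl⟩ | ⟨m, rfl⟩
  · exact ⟨m, append_mem_cylinder_iff.1 hz, hzU⟩
  · refine ⟨[], ⟨ρ, rfl⟩, ?_⟩
    rw [List.append_nil]
    exact (cylinder_append_subset z m).trans hzU

theorem continuous_append (w : List X) : Continuous (append w) := by
  refine ⟨fun U hU => isOpen_infWord_iff.2 fun ρ hρ => ?_⟩
  obtain ⟨p, hp, hpU⟩ := exists_cylinder_subset hU w hρ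
  exact ⟨p, hp, fun σ hσ => hpU (append_mem_cylinder_iff.2 hσ)⟩

theorem isOpenMap_append (w : List X) : IsOpenMap (append w) := by
  intro U hU
  refine isOpen_infWord_iff.2 ?_
  rintro _ ⟨ρ, hρ, rfl⟩
  obtain ⟨p, hp, hpU⟩ := isOpen_infWord_iff.1 hU ρ hρ
  refine ⟨w ++ p, append_mem_cylinder_iff.2 hp, ?_⟩
  rintro _ ⟨τ, rfl⟩
  exact ⟨append p τ, hpU ⟨τ, rfl⟩, (append_append _ _ _).symm⟩

instance [Finite X] : CompactSpace (InfWord X) :=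
  letI : TopologicalSpace X := ⊥
  inferInstanceAs (CompactSpace (ℕ → X))

end InfiniteWords

/-! ### The action on words -/

section Action

variable {G X : Type*} [Group G] [MulAction G (InfWord X)] [IsSelfSimilar G X]

@[simp]
theorem length_wordAct (g : G) (p : List X) : (wordAct g p).length = p.length := by
  induction p generalizing g with
  | nil => rfl
  | cons x p ih => simp [wordAct, ih]

instance : ContinuousConstSMul G (InfWord X) where
  continuous_const_smul g := by
    refine ⟨fun U hU => isOpen_infWord_iff.2 fun ρ hρ => ?_⟩
    obtain ⟨w, hw, hwU⟩ := isOpen_infWord_iff.1 hU _ hρ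
    refine ⟨initial w.length ρ, mem_cylinder_initial _ _, fun η hη => hwU ?_⟩
    rw [mem_cylinder_initial_iff] at hη
    have h := (IsSelfSimilar.isometry g η ρ w.length).2 hη
    rw [mem_cylinder_iff] at hw ⊢
    exact fun i hi => (h i hi).trans (hw i hi)

theorem wordAct_of_append_fixed {g : G} {u v : List X} (h : wordAct g (u ++ v) = u ++ v) :
    wordAct g u = u ∧ wordAct (wordSection g u) v = v := by
  rw [wordAct_append] at h
  exact List.append_inj h (length_wordAct g u)

end Action

/-! ### Germs and their topology -/

section Arrows

variable {G X : Type*} [Group G] [MulAction G (InfWord X)] [IsSelfSimilar G X]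

/-- The germ of `s_v u_g s_w^*` at `wρ`. Every germ has this form. -/
def arrow (v : List X) (g : G) (w : List X) (ρ : InfWord X) : Germ G X :=
  germ ⟨v, g, w⟩ (append w ρ) ⟨ρ, rfl⟩

theorem exists_eq_arrow (γ : Germ G X) : ∃ v g w ρ, γ = arrow v g w ρ := by
  induction γ using Quotient.inductionOn with
  | h a =>
    obtain ⟨⟨⟨v, g, w⟩, σ⟩, ⟨ρ, h⟩⟩ := a
    obtain rfl : σ = append w ρ := h
    exact ⟨v, g, w, ρ, rfl⟩

theorem germ_eq_germ_iff {s t : Elem G X} {ρ σ : InfWord X} {h : ρ ∈ cylinder s.w}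
    {k : σ ∈ cylinder t.w} :
    germ s ρ h = germ t σ k ↔
      ρ = σ ∧ ∃ p q, ρ ∈ cylinder (s.w ++ p) ∧ s.restrict p = t.restrict q :=
  Quotient.eq

theorem source_arrow (v : List X) (g : G) (w : List X) (ρ : InfWord X) :
    (arrow v g w ρ).source = append w ρ := rfl

theorem range_arrow (v : List X) (g : G) (w : List X) (ρ : InfWord X) :
    (arrow v g w ρ).range = append v (g • ρ) := by
  change append v (g • drop w.length (append w ρ)) = _
  rw [drop_append]

theorem arrow_append (v : List X) (g : G) (w p : List X) (ρ : InfWord X) :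
    arrow v g w (append p ρ) = arrow (v ++ wordAct g p) (wordSection g p) (w ++ p) ρ := by
  refine germ_eq_germ_iff.2 ⟨(append_append _ _ _).symm, p, [], ?_, ?_⟩
  · exact append_mem_cylinder_iff.2 ⟨ρ, rfl⟩
  · simp [Elem.restrict, wordAct, wordSection]

theorem arrow_eq_arrow_iff {v v' : List X} {g h : G} {w : List X} {ρ : InfWord X} :
    arrow v g w ρ = arrow v' h w ρ ↔ v = v' ∧
      ∃ p, ρ ∈ cylinder p ∧ wordAct g p = wordAct h p ∧ wordSection g p = wordSection h p := by
  constructor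
  · intro H
    obtain ⟨-, p, q, hp, H⟩ := germ_eq_germ_iff.1 H
    simp only [Elem.restrict, Elem.mk.injEq, List.append_cancel_left_eq] at H
    obtain ⟨H1, H2, rfl⟩ := H
    obtain ⟨rfl, H3⟩ := List.append_inj' H1 (by simp)
    exact ⟨rfl, p, append_mem_cylinder_iff.1 hp, H3, H2⟩
  · rintro ⟨rfl, p, ⟨τ, rfl⟩, h1, h2⟩
    rw [arrow_append, arrow_append, h1, h2]

/-- Comparison of germs whose source words agree reduces to germs of group elements. -/
theorem arrow_eq_arrow_iff_nil {v v' : List X} {g h : G} {w : List X} {ρ : InfWord X} :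
    arrow v g w ρ = arrow v' h w ρ ↔ v = v' ∧ arrow [] g [] ρ = arrow [] h [] ρ := by
  simp [arrow_eq_arrow_iff]

theorem arrow_mul_left (k : G) {g h : G} {ρ : InfWord X}
    (H : arrow [] g [] ρ = arrow [] h [] ρ) :
    arrow [] (k * g) [] ρ = arrow [] (k * h) [] ρ := by
  obtain ⟨-, p, hp, h1, h2⟩ := arrow_eq_arrow_iff.1 H
  refine arrow_eq_arrow_iff.2 ⟨rfl, p, hp, ?_, ?_⟩
  · rw [(word_mul k g p).1, (word_mul k h p).1, h1]
  · rw [(word_mul k g p).2, (word_mul k h p).2, h1, h2]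

theorem arrow_mul_eq_iff {k g h : G} {ρ : InfWord X} :
    arrow [] (k * g) [] ρ = arrow [] h [] ρ ↔ arrow [] g [] ρ = arrow [] (k⁻¹ * h) [] ρ := by
  constructor
  · intro H
    simpa using arrow_mul_left k⁻¹ H
  · intro H
    simpa using arrow_mul_left k H

theorem arrow_mem_range_iff {v v' : List X} {g h : G} {w p : List X} {ρ : InfWord X} :
    arrow v g (w ++ p) ρ ∈ range (arrow v' h w) ↔
      v = v' ++ wordAct h p ∧ arrow [] g [] ρ = arrow [] (wordSection h p) [] ρ := by
  rw [← arrow_eq_arrow_iff_nil (w := w ++ p), ← arrow_append]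
  constructor
  · rintro ⟨σ, hσ⟩
    have h1 := congrArg Germ.source hσ
    rw [source_arrow, source_arrow, append_append] at h1
    rw [← hσ, append_inj w h1]
  · intro H
    exact ⟨_, H.symm⟩

theorem arrow_nil_mem_range_iff {g h : G} {ρ : InfWord X} :
    arrow [] g [] ρ ∈ range (arrow [] h []) ↔ arrow [] g [] ρ = arrow [] h [] ρ := by
  simpa [wordAct, wordSection] using
    arrow_mem_range_iff (v := []) (v' := []) (g := g) (h := h) (w := []) (p := []) (ρ := ρ)

theorem germSet_append_image (v : List X) (g : G) (w : List X) (U : Set (InfWord X)) :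
    germSet ⟨v, g, w⟩ (append w '' U) = arrow v g w '' U := by
  ext γ
  constructor
  · rintro ⟨_, _, ⟨ρ, hρ, rfl⟩, rfl⟩
    exact ⟨ρ, hρ, rfl⟩
  · rintro ⟨ρ, hρ, rfl⟩
    exact ⟨_, ⟨ρ, rfl⟩, ⟨ρ, hρ, rfl⟩, rfl⟩

theorem germSet_univ (g : G) :
    germSet (⟨[], g, []⟩ : Elem G X) univ = range (arrow [] g []) := by
  rw [← image_univ, ← germSet_append_image]
  congr 1
  exact (image_id _).symm

theorem isOpenMap_arrow (v : List X) (g : G) (w : List X) : IsOpenMap (arrow v g w) := by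
  intro U hU
  rw [← germSet_append_image]
  exact TopologicalSpace.isOpen_generateFrom_of_mem ⟨_, _, isOpenMap_append w U hU, rfl⟩

theorem continuous_arrow (v : List X) (g : G) (w : List X) : Continuous (arrow v g w) := by
  refine continuous_generateFrom_iff.2 ?_
  rintro _ ⟨s, U, hU, rfl⟩
  refine isOpen_iff_forall_mem_open.2 ?_
  rintro ρ ⟨_, h, hρU, H⟩
  obtain ⟨rfl, p, q, hp, H⟩ := germ_eq_germ_iff.1 H
  refine ⟨cylinder p ∩ append w ⁻¹' U, ?_,
    (isOpen_cylinder p).inter (hU.preimage (continuous_append w)),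
    append_mem_cylinder_iff.1 hp, hρU⟩
  rintro σ ⟨hσ, hσU⟩
  have hw : append w σ ∈ cylinder (w ++ p) := append_mem_cylinder_iff.2 hσ
  have hs : append w σ ∈ cylinder s.w :=
    cylinder_append_subset s.w q (by rw [← Elem.w_eq H]; exact hw)
  exact ⟨append w σ, hs, hσU, germ_eq_germ_iff.2 ⟨rfl, p, q, hw, H⟩⟩

/-- The groupoid of germs carries the final topology for the charts `arrow v g w`. -/
theorem isOpen_germ_iff {A : Set (Germ G X)} :
    IsOpen A ↔ ∀ v g w, IsOpen (arrow v g w ⁻¹' A) := by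
  refine ⟨fun hA v g w => hA.preimage (continuous_arrow v g w), fun H => ?_⟩
  refine isOpen_iff_forall_mem_open.2 fun γ hγ => ?_
  obtain ⟨v, g, w, ρ, rfl⟩ := exists_eq_arrow γ
  exact ⟨_, image_preimage_subset _ _, isOpenMap_arrow v g w _ (H v g w), ρ, hγ, rfl⟩

theorem continuous_source : Continuous (Germ.source : Germ G X → InfWord X) :=
  ⟨fun _ hU => isOpen_germ_iff.2 fun _ _ w => hU.preimage (continuous_append w)⟩

theorem isBisection_range_arrow (g : G) :
    IsBisection (range (arrow [] g [] : InfWord X → Germ G X)) := by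
  let e : range (arrow [] g [] : InfWord X → Germ G X) ≃ₜ InfWord X :=
    { toFun := fun γ => γ.1.source
      invFun := fun ρ => ⟨arrow [] g [] ρ, ρ, rfl⟩
      left_inv := by
        rintro ⟨_, ρ, rfl⟩
        rfl
      right_inv := fun ρ => rfl
      continuous_toFun := continuous_source.comp continuous_subtype_val
      continuous_invFun := (continuous_arrow [] g []).subtype_mk _ }
  refine ⟨e.isEmbedding, ?_⟩
  have h : (fun γ : range (arrow [] g [] : InfWord X → Germ G X) => γ.1.range) =
      fun γ => (e.trans (Homeomorph.smul g)) γ := by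
    funext ⟨_, ρ, rfl⟩
    exact range_arrow [] g [] ρ
  rw [h]
  exact (e.trans (Homeomorph.smul g)).isEmbedding

theorem unitaryElem_eq (g : G) :
    (unitaryElem g : Germ G X → ℂ) = (range (arrow [] g [])).indicator fun _ => 1 := by
  rw [unitaryElem, germSet_univ]

theorem unitaryElem_mem [Finite X] (g : G) : unitaryElem g ∈ groupoidAlgebra G X :=
  Submodule.subset_span ⟨_, isCompact_range (continuous_arrow [] g []),
    (isOpenMap_arrow [] g []).isOpen_range, isBisection_range_arrow g, unitaryElem_eq g⟩

end Arrows

/-! ### Indicator functions that span the groupoid algebra -/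

section Spanning

variable {G X : Type*} [Group G] [MulAction G (InfWord X)] [IsSelfSimilar G X]

variable (G X) in
/-- The span of the indicator functions of the sets of all germs of the elements of `S(G, X)`. -/
def arrowSpan : Submodule ℂ (Germ G X → ℂ) :=
  Submodule.span ℂ (range fun s : Elem G X =>
    (range (arrow s.v s.g s.w)).indicator fun _ => (1 : ℂ))

/-- Inside a set on which the source map is injective, the germ sets of two elements of `S(G, X)`
are nested or disjoint, because cylinders are. -/
theorem range_arrow_subset_or {A : Set (Germ G X)} (hA : InjOn Germ.source A) {s t : Elem G X}
    (hs : range (arrow s.v s.g s.w) ⊆ A) (ht : range (arrow t.v t.g t.w) ⊆ A)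
    (hst : ¬ Disjoint (range (arrow s.v s.g s.w)) (range (arrow t.v t.g t.w))) :
    range (arrow s.v s.g s.w) ⊆ range (arrow t.v t.g t.w) ∨
      range (arrow t.v t.g t.w) ⊆ range (arrow s.v s.g s.w) := by
  have key : ∀ s t : Elem G X, range (arrow s.v s.g s.w) ⊆ A → range (arrow t.v t.g t.w) ⊆ A →
      (∃ m, s.w = t.w ++ m) → range (arrow s.v s.g s.w) ⊆ range (arrow t.v t.g t.w) := by
    rintro s t hs ht ⟨m, hm⟩ _ ⟨ρ, rfl⟩
    refine ⟨append m ρ, hA (ht ⟨_, rfl⟩) (hs ⟨_, rfl⟩) ?_⟩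
    rw [source_arrow, source_arrow, hm, append_append]
  obtain ⟨_, ⟨ρ, rfl⟩, σ, hσ⟩ := not_disjoint_iff.1 hst
  have h := congrArg Germ.source hσ
  rw [source_arrow, source_arrow] at h
  rcases prefix_total s.w t.w ⟨ρ, rfl⟩ ⟨σ, h.symm⟩ with H | H
  · exact .inr (key t s ht hs H)
  · exact .inl (key s t hs ht H)

theorem indicator_iUnion_mem_arrowSpan {A : Set (Germ G X)} (hA : InjOn Germ.source A)
    (F : Finset (Elem G X)) (hF : ∀ s ∈ F, range (arrow s.v s.g s.w) ⊆ A) :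
    (⋃ s ∈ F, range (arrow s.v s.g s.w)).indicator (fun _ => (1 : ℂ)) ∈ arrowSpan G X := by
  classical
  induction F using Finset.strongInduction with
  | H F ih =>
    by_cases hd : (F : Set (Elem G X)).PairwiseDisjoint fun s => range (arrow s.v s.g s.w)
    · rw [Finset.indicator_biUnion F _ hd]
      have : (fun γ : Germ G X => ∑ s ∈ F, (range (arrow s.v s.g s.w)).indicator
          (fun _ => (1 : ℂ)) γ) =
          ∑ s ∈ F, (range (arrow s.v s.g s.w)).indicator (fun _ => (1 : ℂ)) := by
        funext γ
        simp
      rw [this]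
      exact Submodule.sum_mem _ fun s _ => Submodule.subset_span ⟨s, rfl⟩
    · -- a set contained in another one of the family can be left out of the union
      have key : ∀ s ∈ F, ∀ t ∈ F, s ≠ t →
          range (arrow s.v s.g s.w) ⊆ range (arrow t.v t.g t.w) →
          (⋃ s ∈ F, range (arrow s.v s.g s.w)).indicator (fun _ => (1 : ℂ)) ∈
            arrowSpan G X := by
        intro s hs t ht hne hst
        have h := ih (F.erase s) (Finset.erase_ssubset hs)
          fun r hr => hF r (Finset.mem_of_mem_erase hr)
        have hU : (⋃ r ∈ F, range (arrow r.v r.g r.w)) =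
            ⋃ r ∈ F.erase s, range (arrow r.v r.g r.w) := by
          refine Subset.antisymm (iUnion₂_subset fun r hr => ?_)
            (biUnion_mono (fun r hr => Finset.mem_of_mem_erase hr) fun _ _ => Subset.rfl)
          by_cases hrs : r = s
          · subst hrs
            exact hst.trans (subset_biUnion_of_mem (u := fun r : Elem G X =>
              range (arrow r.v r.g r.w)) (Finset.mem_erase.2 ⟨hne.symm, ht⟩))
          · exact subset_biUnion_of_mem (u := fun r : Elem G X =>
              range (arrow r.v r.g r.w)) (Finset.mem_erase.2 ⟨hrs, hr⟩)
        rwa [hU]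
      simp only [Set.PairwiseDisjoint, Set.Pairwise, not_forall] at hd
      obtain ⟨s, hs, t, ht, hne, hst⟩ := hd
      rcases range_arrow_subset_or hA (hF s hs) (hF t ht) hst with h | h
      · exact key s hs t ht hne h
      · exact key t ht s hs hne.symm h

theorem groupoidAlgebra_le_arrowSpan : groupoidAlgebra G X ≤ arrowSpan G X := by
  refine Submodule.span_le.2 ?_
  rintro _ ⟨A, hc, ho, hb, rfl⟩
  have hA : InjOn Germ.source A := injOn_iff_injective.2 hb.1.injective
  have hcov : ∀ γ ∈ A, ∃ s : Elem G X, range (arrow s.v s.g s.w) ⊆ A ∧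
      γ ∈ range (arrow s.v s.g s.w) := by
    intro γ hγ
    obtain ⟨v, g, w, ρ, rfl⟩ := exists_eq_arrow γ
    obtain ⟨p, ⟨τ, rfl⟩, hpA⟩ := isOpen_infWord_iff.1 (isOpen_germ_iff.1 ho v g w) ρ hγ
    refine ⟨⟨v ++ wordAct g p, wordSection g p, w ++ p⟩, ?_, τ, (arrow_append _ _ _ _ _).symm⟩
    rintro _ ⟨σ, rfl⟩
    rw [← arrow_append]
    exact hpA ⟨σ, rfl⟩
  choose s hsA hs using hcov
  obtain ⟨t, htA⟩ := hc.elim_nhds_subcover'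
    (fun γ hγ => range (arrow (s γ hγ).v (s γ hγ).g (s γ hγ).w))
    fun γ hγ => (isOpenMap_arrow _ _ _).isOpen_range.mem_nhds (hs γ hγ)
  classical
  -- the finite subcover, as a finite set of elements of `S(G, X)`
  have hF : ∀ r ∈ t.image fun γ => s γ.1 γ.2, range (arrow r.v r.g r.w) ⊆ A := by
    intro r hr
    obtain ⟨γ, -, rfl⟩ := Finset.mem_image.1 hr
    exact hsA γ.1 γ.2
  have h := indicator_iUnion_mem_arrowSpan hA (t.image fun γ => s γ.1 γ.2) hF
  have hAF : A = ⋃ r ∈ t.image fun γ => s γ.1 γ.2, range (arrow r.v r.g r.w) :=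
    Subset.antisymm (by rwa [Finset.set_biUnion_finset_image]) (iUnion₂_subset hF)
  rwa [← hAF] at h

end Spanning

/-! ### Compression to the group algebra -/

section Compression

variable {G X : Type*} [Group G] [MulAction G (InfWord X)] [IsSelfSimilar G X]

variable (X) in
/-- The linear map that sends a finitely supported function `c` on `G`, an element of the group
algebra, to `∑ c_g u_g` in `ℂ𝒢`. -/
def groupElem : (G →₀ ℂ) →ₗ[ℂ] (Germ G X → ℂ) := Finsupp.linearCombination ℂ unitaryElem

theorem groupElem_mem [Finite X] (c : G →₀ ℂ) : groupElem X c ∈ groupoidAlgebra G X :=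
  Submodule.sum_mem _ fun g _ => Submodule.smul_mem _ _ (unitaryElem_mem g)

theorem groupElem_single (g : G) (a : ℂ) : groupElem X (Finsupp.single g a) = a • unitaryElem g :=
  Finsupp.linearCombination_single ..

theorem indicator_one_congr {α β : Type*} {A : Set α} {B : Set β} {a : α} {b : β}
    (h : a ∈ A ↔ b ∈ B) : A.indicator (fun _ => (1 : ℂ)) a = B.indicator (fun _ => 1) b := by
  by_cases ha : a ∈ A
  · simp [ha, h.1 ha]
  · simp [ha, mt h.2 ha]

/-- On the germs `s_v u_k [u_g, ρ] s_w^*`, for a long word `w`, an element of `ℂ𝒢` is given by an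
element of the group algebra. -/
theorem exists_groupElem_eq {f : Germ G X → ℂ} (hf : f ∈ arrowSpan G X) :
    ∃ n, ∀ (v : List X) (k : G) (w : List X), n ≤ w.length →
      ∃ c, ∀ g ρ, groupElem X c (arrow [] g [] ρ) = f (arrow v (k * g) w ρ) := by
  induction hf using Submodule.span_induction with
  | zero => exact ⟨0, fun v k w _ => ⟨0, fun g ρ => by simp⟩⟩
  | add f₁ f₂ _ _ h₁ h₂ =>
    obtain ⟨n₁, h₁⟩ := h₁
    obtain ⟨n₂, h₂⟩ := h₂
    refine ⟨max n₁ n₂, fun v k w hw => ?_⟩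
    obtain ⟨c₁, hc₁⟩ := h₁ v k w (le_trans (le_max_left _ _) hw)
    obtain ⟨c₂, hc₂⟩ := h₂ v k w (le_trans (le_max_right _ _) hw)
    exact ⟨c₁ + c₂, fun g ρ => by simp [hc₁, hc₂]⟩
  | smul a f _ h =>
    obtain ⟨n, h⟩ := h
    refine ⟨n, fun v k w hw => ?_⟩
    obtain ⟨c, hc⟩ := h v k w hw
    exact ⟨a • c, fun g ρ => by simp [hc]⟩
  | mem f hf =>
    obtain ⟨⟨v', h, w'⟩, rfl⟩ := hf
    refine ⟨w'.length, fun v k w hw => ?_⟩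
    by_cases H : ∃ p, w = w' ++ p ∧ v = v' ++ wordAct h p
    · obtain ⟨p, rfl, rfl⟩ := H
      refine ⟨Finsupp.single (k⁻¹ * wordSection h p) 1, fun g ρ => ?_⟩
      rw [groupElem_single, one_smul, unitaryElem_eq]
      refine indicator_one_congr ?_
      rw [arrow_mem_range_iff, arrow_nil_mem_range_iff, arrow_mul_eq_iff]
      simp
    · refine ⟨0, fun g ρ => ?_⟩
      rw [map_zero, Pi.zero_apply, eq_comm]
      refine indicator_of_notMem (fun hmem => H ?_) _
      have hw' : append w ρ ∈ cylinder w' := by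
        obtain ⟨σ, hσ⟩ := hmem
        exact ⟨σ, (congrArg Germ.source hσ).symm⟩
      obtain ⟨p, rfl⟩ : ∃ p, w = w' ++ p := by
        rcases prefix_total w' w hw' ⟨ρ, rfl⟩ with H | ⟨m, rfl⟩
        · exact H
        · have hm : m = [] := List.eq_nil_of_length_eq_zero (by rw [List.length_append] at hw; omega)
          exact ⟨[], by simp [hm]⟩
      exact ⟨p, rfl, (arrow_mem_range_iff.1 hmem).1⟩

/-- Emptiness of the interior of the support is inherited from an element of `ℂ𝒢` by its
compressions, as `arrow [] g [] ρ ↦ arrow v (k * g) w ρ` is open. -/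
theorem interior_support_groupElem {c : G →₀ ℂ} {f : Germ G X → ℂ}
    (hf : interior (Function.support f) = ∅) {v w : List X} {k : G}
    (H : ∀ g ρ, groupElem X c (arrow [] g [] ρ) = f (arrow v (k * g) w ρ)) :
    interior (Function.support (groupElem X c)) = ∅ := by
  refine eq_empty_of_forall_notMem fun γ hγ => ?_
  obtain ⟨g, ρ, rfl⟩ : ∃ g, γ ∈ range (arrow [] g []) := by
    have h : groupElem X c γ ≠ 0 := interior_subset hγ
    rw [groupElem, Finsupp.linearCombination_apply, Finsupp.sum, Finset.sum_apply] at h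
    obtain ⟨g, -, hg⟩ := Finset.exists_ne_zero_of_sum_ne_zero h
    rw [Pi.smul_apply, unitaryElem_eq] at hg
    exact ⟨g, mem_of_indicator_ne_zero (right_ne_zero_of_smul hg)⟩
  have hU : IsOpen (arrow [] g [] ⁻¹' interior (Function.support (groupElem X c))) :=
    isOpen_interior.preimage (continuous_arrow [] g [])
  have h : arrow v (k * g) w '' (arrow [] g [] ⁻¹' interior (Function.support (groupElem X c))) ⊆
      interior (Function.support f) := by
    refine interior_maximal ?_ (isOpenMap_arrow _ _ _ _ hU)
    rintro _ ⟨σ, hσ, rfl⟩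
    rw [Function.mem_support, ← H]
    exact interior_subset (s := Function.support (groupElem X c)) hσ
  rw [hf] at h
  exact h ⟨ρ, hγ, rfl⟩

open Classical in
/-- The linear map on `ℂG` that sends `h` to `h|_u` if `h(u) = u` and to `0` otherwise, that
is, `a ↦ s_u^* a s_u`. -/
def stabilizerSection (u : List X) : (G →₀ ℂ) →ₗ[ℂ] (G →₀ ℂ) :=
  Finsupp.linearCombination ℂ fun h =>
    if wordAct h u = u then Finsupp.single (wordSection h u) 1 else 0

theorem exists_of_stabilizerSection_ne_zero {u : List X} {c : G →₀ ℂ} {k : G}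
    (hk : stabilizerSection u c k ≠ 0) :
    ∃ h ∈ c.support, wordAct h u = u ∧ wordSection h u = k := by
  rw [stabilizerSection, Finsupp.linearCombination_apply, Finsupp.sum, Finsupp.finsetSum_apply] at hk
  obtain ⟨h, hc, hk⟩ := Finset.exists_ne_zero_of_sum_ne_zero hk
  refine ⟨h, hc, ?_⟩
  by_contra! H
  refine hk ?_
  split_ifs with hu
  · simp [H hu]
  · simp

theorem groupElem_stabilizerSection (u : List X) (c : G →₀ ℂ) (g : G) (ρ : InfWord X) :
    groupElem X (stabilizerSection u c) (arrow [] g [] ρ) = groupElem X c (arrow u g u ρ) := by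
  induction c using Finsupp.induction_linear with
  | zero => simp
  | add c₁ c₂ h₁ h₂ => simp [h₁, h₂]
  | single h a =>
    have hmem : arrow u g u ρ ∈ range (arrow [] h []) ↔
        u = wordAct h u ∧ arrow [] g [] ρ = arrow [] (wordSection h u) [] ρ :=
      arrow_mem_range_iff (w := [])
    rw [stabilizerSection, Finsupp.linearCombination_single, groupElem_single, map_smul,
      Pi.smul_apply, Pi.smul_apply, unitaryElem_eq h]
    congr 1
    split_ifs with hu
    · rw [groupElem_single, one_smul, unitaryElem_eq]
      refine indicator_one_congr ?_
      rw [hmem, arrow_nil_mem_range_iff]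
      exact (and_iff_right hu.symm).symm
    · rw [map_zero, Pi.zero_apply, eq_comm]
      exact indicator_of_notMem (fun h => hu (hmem.1 h).1.symm) _

theorem exists_ofGroupAlgebra_eq {w : List X} {c : G →₀ ℂ}
    (hc : ∀ g ∈ c.support, g ∈ cycleSubgroup G w) :
    ∃ a : MonoidAlgebra ℂ (cycleSubgroup G w), ofGroupAlgebra a = groupElem X c :=
  ⟨.ofCoeff (c.subtypeDomain (· ∈ cycleSubgroup G w)),
    Finsupp.sum_subtypeDomain_index (h := fun g a => a • unitaryElem g) hc⟩

end Compression

/-! ### Repetition of sections along an infinite word -/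

section Contraction

variable {G X : Type*} [Group G] [MulAction G (InfWord X)] [IsSelfSimilar G X]

theorem wordSection_mem {N : Set G} (hN : ∀ g ∈ N, ∀ x : X, letterSection g x ∈ N) {g : G}
    (hg : g ∈ N) (u : List X) : wordSection g u ∈ N := by
  induction u generalizing g with
  | nil => exact hg
  | cons x u ih => exact ih (hN g hg x)

theorem eventually_wordSection_mem {N : Set G} (hN : ∀ g ∈ N, ∀ x : X, letterSection g x ∈ N)
    {g : G} (hg : ∃ m : ℕ, ∀ w : List X, w.length = m → wordSection g w ∈ N) (ξ : InfWord X) :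
    ∃ m, ∀ n, m ≤ n → wordSection g (initial n ξ) ∈ N := by
  obtain ⟨m, hm⟩ := hg
  refine ⟨m, fun n hn => ?_⟩
  obtain ⟨j, rfl⟩ := Nat.exists_eq_add_of_le hn
  rw [initial_add, wordSection_append]
  exact wordSection_mem hN (hm _ (length_initial _ _)) _

theorem wordAct_initial_of_le {g : G} {m n : ℕ} (hmn : m ≤ n) {ξ : InfWord X}
    (h : wordAct g (initial n ξ) = initial n ξ) : wordAct g (initial m ξ) = initial m ξ := by
  obtain ⟨j, rfl⟩ := Nat.exists_eq_add_of_le hmn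
  rw [initial_add] at h
  exact (wordAct_of_append_fixed h).1

/-- Along an infinite word `ξ` there are prefixes `u` and `uw`, `w` non-empty, such that for each
`h` in a given finite set that fixes `u` the section `h|_u` lies in `H_w`. By contraction the
sections of these `h` at the prefixes of `ξ` are eventually in a finite set, so that two prefixes
give the same sections. -/
theorem exists_wordSection_mem_cycleSubgroup (hcontr : IsContracting G X) (S : Finset G)
    (ξ : InfWord X) :
    ∃ (n : ℕ) (w : List X), w ≠ [] ∧ ∀ h ∈ S, wordAct h (initial n ξ) = initial n ξ →
      wordSection h (initial n ξ) ∈ cycleSubgroup G w := by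
  obtain ⟨N, hfin, hN, hcon⟩ := hcontr
  choose m hm using fun g : G => eventually_wordSection_mem hN (hcon g) ξ
  -- past length `l g`, an element `g` fixes no prefix of `ξ` unless it fixes all of them
  have hfix : ∀ g : G, ∃ l, ∀ n, l ≤ n → wordAct g (initial n ξ) = initial n ξ →
      ∀ i, wordAct g (initial i ξ) = initial i ξ := by
    intro g
    by_cases H : ∀ i, wordAct g (initial i ξ) = initial i ξ
    · exact ⟨0, fun _ _ _ => H⟩
    · obtain ⟨l, hl⟩ := not_forall.1 H
      exact ⟨l, fun n hn hg => absurd (wordAct_initial_of_le hn hg) hl⟩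
  choose l hl using hfix
  let b := S.sup fun g => max (m g) (l g)
  have hb : ∀ g ∈ S, m g ≤ b ∧ l g ≤ b := fun g hg =>
    max_le_iff.1 (Finset.le_sup (f := fun g => max (m g) (l g)) hg)
  have hpi : {q : S → G | ∀ g, q g ∈ N}.Finite := Set.Finite.pi' fun _ => hfin
  have hmaps : ∀ n : ℕ, (fun g : S => wordSection g.1 (initial (b + n) ξ)) ∈
      {q : S → G | ∀ g, q g ∈ N} :=
    fun n g => hm g.1 _ ((hb g.1 g.2).1.trans (Nat.le_add_right _ _))
  obtain ⟨i, j, hij, heq⟩ := hpi.exists_lt_map_eq_of_forall_mem hmaps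
  obtain ⟨d, rfl⟩ := Nat.exists_eq_add_of_lt hij
  have hd : b + (i + d + 1) = b + i + (d + 1) := by omega
  refine ⟨b + i, initial (d + 1) (drop (b + i) ξ), ?_, fun h hS hfix => ?_⟩
  · intro h
    simpa using congrArg List.length h
  · have hall := hl h _ ((hb h hS).2.trans (Nat.le_add_right _ _)) hfix (b + i + (d + 1))
    rw [initial_add] at hall
    have hsec : wordSection h (initial (b + i + (d + 1)) ξ) = wordSection h (initial (b + i) ξ) :=
      hd ▸ (congrFun heq ⟨h, hS⟩).symm
    rw [initial_add, wordSection_append] at hsec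
    exact ⟨(wordAct_of_append_fixed hall).2, hsec⟩

end Contraction

end SelfSimilar

end

/-! ### Elements of the essential ideal in the algebras of the groups `H_w` -/

open SelfSimilar in
theorem propositionp {G X : Type*} [Group G] [Finite X] [MulAction G (SelfSimilar.InfWord X)]
    [SelfSimilar.IsSelfSimilar G X] (hcontr : SelfSimilar.IsContracting G X)
    (hess : ∃ f ∈ SelfSimilar.algEssentialIdeal G X, f ≠ 0) :
    ∃ w : List X, w ≠ [] ∧ ∃ a : MonoidAlgebra ℂ (SelfSimilar.cycleSubgroup G w),
      a ≠ 0 ∧ SelfSimilar.ofGroupAlgebra a ∈ SelfSimilar.algEssentialIdeal G X ∧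
        SelfSimilar.ofGroupAlgebra a ≠ 0 := by
  obtain ⟨f, ⟨hf, hint⟩, hne⟩ := hess
  obtain ⟨γ, hγ⟩ := Function.ne_iff.1 hne
  obtain ⟨l, hl⟩ := exists_groupElem_eq (groupoidAlgebra_le_arrowSpan hf)
  obtain ⟨v, k, w, ξ, hvk, hlw⟩ : ∃ v k w ξ, γ = arrow v k w ξ ∧ l ≤ w.length := by
    obtain ⟨v, k, w, ξ, rfl⟩ := exists_eq_arrow γ
    -- restriction of the element of `S(G, X)` lengthens its source word
    have h := arrow_append v k w (initial l ξ) (drop l ξ)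
    rw [append_initial_drop] at h
    exact ⟨_, _, _, _, h, by simp⟩
  obtain ⟨c, hc⟩ := hl v k w hlw
  have hc1 : groupElem X c (arrow [] 1 [] ξ) ≠ 0 := by
    rw [hc, mul_one, ← hvk]
    exact hγ
  obtain ⟨n, z, hz, hmem⟩ := exists_wordSection_mem_cycleSubgroup hcontr c.support ξ
  obtain ⟨a, ha⟩ := exists_ofGroupAlgebra_eq (w := z) (c := stabilizerSection (initial n ξ) c) (by
    intro g hg
    obtain ⟨h, hS, hu, rfl⟩ :=
      exists_of_stabilizerSection_ne_zero (Finsupp.mem_support_iff.1 hg)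
    exact hmem h hS hu)
  have hne : ofGroupAlgebra a ≠ 0 := by
    intro h0
    rw [ha] at h0
    have h1 := groupElem_stabilizerSection (initial n ξ) c 1 (drop n ξ)
    have h2 := arrow_append [] (1 : G) [] (initial n ξ) (drop n ξ)
    rw [append_initial_drop, (word_one _).1, (word_one _).2, List.nil_append] at h2
    rw [h0, ← h2] at h1
    exact hc1 h1.symm
  refine ⟨z, hz, a, ?_, ⟨ha ▸ groupElem_mem _, ?_⟩, hne⟩
  · rintro rfl
    exact hne (by simp [ofGroupAlgebra])
  · rw [ha]
    refine interior_support_groupElem (interior_support_groupElem hint hc)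
      (v := initial n ξ) (w := initial n ξ) (k := 1) fun g ρ => ?_
    rw [one_mul]
    exact groupElem_stabilizerSection _ _ _ _
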